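/- Let $E$ be a Euclidean space (a finite-dimensional real inner product space). For $F\subset E$ write $d_F(x)=\inf_{z\in F}\|z-x\|$ and $P_F(x)=\operatorname{argmin}\{\|z-x\| : z\in F\}$ (a possibly empty or multivalued projection), and define the normal cone at $\bar x\in F$ by \[ N_F(\bar x)=\Big\{\lim_{r\to\infty} t_r(x_r-z_r)\ :\ t_r\ge 0,\ x_r\to\bar x,\ z_r\in P_F(x_r)\Big\}. \] The set $F$ is prox-regular at $\bar x\in F$ if $P_F(x)$ is a singleton for every $x$ in some neighborhood of $\bar x$. Sets $F_1,\dots,F_m\subset E$ have strongly regular intersection at $\bar x\in\bigcap_i F_i$ if the only vectors $y_i\in N_{F_i}(\bar x)$ $(i=1,\dots,m)$ with $\sum_i y_i=0$ are $y_1=\dots=y_m=0$. The condition modulus $\operatorname{cond}(F_1,\dots,F_m\,|\,\bar x)$ is the infimum of all $k>0$ such that \[ y_i\in N_{F_i}(\bar x)\ (i=1,\dots,m)\quad\Longrightarrow\quad \sqrt{\textstyle\sum_i\|y_i\|^2}\le k\,\Big\|\textstyle\sum_i y_i\Big\|. \] \textbf{Proposition (gradient of mean-squared-distance).} Let $F_1,\dots,F_m\subset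 E$ be sets that are prox-regular at a point $\bar x\in\bigcap_i F_i$ and have strongly regular intersection at $\bar x$, and let $k>\operatorname{cond}(F_1,\dots,F_m\,|\,\bar x)$ be a real constant. Then there is a neighborhood of $\bar x$ on which the function \[ f=\frac1{2m}\sum_{i=1}^m d_{F_i}^2 \] is differentiable and satisfies \[ \tfrac12\|\nabla f\|^2\ \le\ f\ \le\ \frac{k^2m}{2}\,\|\nabla f\|^2 . \] -/

import Mathlib

open Filter Topology

/-- Every Euclidean space (finite-dimensional real inner product space) is complete; this is
what Mathlib's gradient asks for. -/
instance euclideanCompleteSpace {E : Type*} [NormedAddCommGroup E] [InnerProductSpace ℝ E]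
    [FiniteDimensional ℝ E] : CompleteSpace E :=
  FiniteDimensional.complete ℝ E

namespace VarAnalysis

variable {E : Type*} [NormedAddCommGroup E] [InnerProductSpace ℝ E]

/-- The multivalued projection `P_F(x) = argmin {‖z - x‖ : z ∈ F}`. -/
def proj (F : Set E) (x : E) : Set E :=
  {z | z ∈ F ∧ ∀ w ∈ F, ‖z - x‖ ≤ ‖w - x‖}

/-- The (limiting) normal cone
`N_F(p) = {lim tᵢ (xᵢ - zᵢ) : tᵢ ≥ 0, xᵢ → p, zᵢ ∈ P_F(xᵢ)}`. -/
def normalCone (F : Set E) (p : E) : Set E :=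
  {v | ∃ (t : ℕ → ℝ) (x z : ℕ → E),
    (∀ i, 0 ≤ t i) ∧ Tendsto x atTop (𝓝 p) ∧ (∀ i, z i ∈ proj F (x i)) ∧
      Tendsto (fun i => t i • (x i - z i)) atTop (𝓝 v)}

/-- `F` is prox-regular at `p ∈ F`: the projection `P_F` is single-valued around `p`. -/
def ProxRegularAt (F : Set E) (p : E) : Prop :=
  p ∈ F ∧ ∀ᶠ x in 𝓝 p, ∃! z, z ∈ proj F x

/-- The family `F₁, …, F_m` has strongly regular intersection at `p ∈ ⋂ᵢ Fᵢ`: the only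
`yᵢ ∈ N_{Fᵢ}(p)` with `∑ yᵢ = 0` are `yᵢ = 0`. -/
def StronglyRegularAt {m : ℕ} (F : Fin m → Set E) (p : E) : Prop :=
  (∀ i, p ∈ F i) ∧
    ∀ y : Fin m → E, (∀ i, y i ∈ normalCone (F i) p) → ∑ i, y i = 0 → ∀ i, y i = 0

/-- The condition modulus `cond(F₁, …, F_m | p)`: the infimum (in the extended reals, so `+∞`
when there is none) of all `k > 0` such that `√(∑ ‖yᵢ‖²) ≤ k ‖∑ yᵢ‖` whenever
`yᵢ ∈ N_{Fᵢ}(p)` for all `i`. -/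
noncomputable def condModulus {m : ℕ} (F : Fin m → Set E) (p : E) : EReal :=
  sInf ((fun k : ℝ => (k : EReal)) '' {k : ℝ | 0 < k ∧
    ∀ y : Fin m → E, (∀ i, y i ∈ normalCone (F i) p) →
      √(∑ i, ‖y i‖ ^ 2) ≤ k * ‖∑ i, y i‖})

/-- The (half) mean-squared-distance function `f = (1 / 2m) ∑ᵢ d_{Fᵢ}²`. -/
noncomputable def meanSqDist {m : ℕ} (F : Fin m → Set E) (x : E) : ℝ :=
  1 / (2 * (m : ℝ)) * ∑ i, Metric.infDist x (F i) ^ 2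

end VarAnalysis

/-!
The two inequalities compare `f` with `∇f` through the residuals `vᵢ = x - Pᵢ x`, where `Pᵢ x` is
a projection of `x` onto `Fᵢ`.

Near a point of prox-regularity the projection is continuous (`continuousAt_proj`): its values stay
bounded, and each of their cluster points lies in the closure of `F`, at minimal distance, and
close enough to the base point to have a projection of its own, hence in `F`. Comparing
`d_F(y)²` with `‖y - P x‖²` and `d_F(x)²` with `‖x - P y‖²` then gives `∇ d_F² = 2 (x - P x)`
(`hasGradientAt_sq_infDist`), so `∇f = (1/m) ∑ vᵢ` and `f = (1/2m) ∑ ‖vᵢ‖²`. The first inequality is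
Cauchy–Schwarz. The second says `√(∑ ‖vᵢ‖²) ≤ k ‖∑ vᵢ‖` near the base point: otherwise, normalizing
the residuals along a sequence of violations and passing to a limit would give normal vectors
violating the bound with every constant smaller than `k` (`eventually_sqrt_sum_le`).
-/

namespace VarAnalysis

section

variable {E : Type*} [NormedAddCommGroup E]

theorem norm_le_sqrt_sum_sq {ι : Type*} [Fintype ι] (v : ι → E) (i : ι) :
    ‖v i‖ ≤ √(∑ j, ‖v j‖ ^ 2) :=
  Real.le_sqrt_of_sq_le
    (Finset.single_le_sum (f := fun j => ‖v j‖ ^ 2) (fun _ _ => sq_nonneg _) (Finset.mem_univ i))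

theorem norm_sum_sq_le {ι : Type*} [Fintype ι] (v : ι → E) :
    ‖∑ i, v i‖ ^ 2 ≤ Fintype.card ι * ∑ i, ‖v i‖ ^ 2 :=
  calc ‖∑ i, v i‖ ^ 2 ≤ (∑ i, ‖v i‖) ^ 2 := by gcongr; exact norm_sum_le _ _
    _ ≤ Fintype.card ι * ∑ i, ‖v i‖ ^ 2 := sq_sum_le_card_mul_sum_sq

theorem infDist_eq_norm_of_mem_proj {F : Set E} {x z : E}
    (hz : z ∈ proj F x) : Metric.infDist x F = ‖z - x‖ := by
  apply le_antisymm
  · rw [← dist_eq_norm, dist_comm]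
    exact Metric.infDist_le_dist_of_mem hz.1
  · refine (Metric.le_infDist ⟨z, hz.1⟩).2 fun w hw => ?_
    rw [dist_comm, dist_eq_norm]
    exact hz.2 w hw

theorem mem_proj_of_norm_eq_infDist {F : Set E} {x z : E}
    (hz : z ∈ F) (h : ‖z - x‖ = Metric.infDist x F) : z ∈ proj F x := by
  refine ⟨hz, fun w hw => ?_⟩
  rw [h, ← dist_eq_norm, dist_comm]
  exact Metric.infDist_le_dist_of_mem hw

theorem mem_of_mem_closure_of_proj_nonempty {F : Set E} {z : E}
    (hz : z ∈ closure F) (h : (proj F z).Nonempty) : z ∈ F := by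
  obtain ⟨w, hw⟩ := h
  have h0 : ‖w - z‖ = 0 := by
    rw [← infDist_eq_norm_of_mem_proj hw, ← Metric.mem_closure_iff_infDist_zero ⟨w, hw.1⟩]
    exact hz
  have : w = z := by rwa [norm_eq_zero, sub_eq_zero] at h0
  exact this ▸ hw.1

end

variable {E : Type*} [NormedAddCommGroup E] [InnerProductSpace ℝ E]

/-- If every point within `δ` of `p ∈ F` has a unique projection, a selection `P` of the
projection is continuous within `δ / 2` of `p`: projecting at most doubles the distance to `p`, so
a cluster point of `P` still has a projection and therefore lies in `F`. -/
theorem continuousAt_proj [FiniteDimensional ℝ E] {F : Set E} {p x : E} {δ : ℝ} {P : E → E}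
    (hp : p ∈ F) (hδ : ∀ y, dist y p < δ → ∃! z, z ∈ proj F y)
    (hP : ∀ᶠ y in 𝓝 x, P y ∈ proj F y) (hx : dist x p < δ / 2) : ContinuousAt P x := by
  have hPx : P x ∈ proj F x := hP.self_of_nhds
  have hxδ : dist x p < δ := by linarith [dist_nonneg (x := x) (y := p)]
  have hlim : Tendsto (fun y => ‖P y - x‖) (𝓝 x) (𝓝 (Metric.infDist x F)) := by
    have h1 : Tendsto (fun y => Metric.infDist y F - dist y x) (𝓝 x)
        (𝓝 (Metric.infDist x F)) := by
      have : Continuous fun y => Metric.infDist y F - dist y x := by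
        have := Metric.continuous_infDist_pt F
        fun_prop
      simpa using this.tendsto x
    have h2 : Tendsto (fun y => Metric.infDist y F + dist y x) (𝓝 x)
        (𝓝 (Metric.infDist x F)) := by
      have : Continuous fun y => Metric.infDist y F + dist y x := by
        have := Metric.continuous_infDist_pt F
        fun_prop
      simpa using this.tendsto x
    refine tendsto_of_tendsto_of_tendsto_of_le_of_le' h1 h2 ?_ ?_
    · filter_upwards [hP] with y hy
      rw [infDist_eq_norm_of_mem_proj hy, ← dist_eq_norm, ← dist_eq_norm]
      linarith [dist_triangle (P y) x y, dist_comm x y]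
    · filter_upwards [hP] with y hy
      rw [infDist_eq_norm_of_mem_proj hy, ← dist_eq_norm, ← dist_eq_norm]
      linarith [dist_triangle (P y) y x]
  have hbdd : ∀ᶠ y in 𝓝 x, P y ∈ Metric.closedBall x (Metric.infDist x F + 1) := by
    filter_upwards [hlim.eventually_lt_const (lt_add_one _)] with y hy
    rw [Metric.mem_closedBall, dist_eq_norm]
    exact hy.le
  refine (isCompact_closedBall x _).tendsto_nhds_of_unique_mapClusterPt hbdd fun z _ hz => ?_
  have hzcl : z ∈ closure F :=
    isClosed_closure.mem_of_mapClusterPt hz (hP.mono fun y hy => subset_closure hy.1)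
  have hznorm : ‖z - x‖ = Metric.infDist x F := by
    have hc : MapClusterPt ‖z - x‖ (𝓝 x) fun y => ‖P y - x‖ :=
      hz.continuousAt_comp (f := fun w => ‖w - x‖) (by fun_prop)
    have : ClusterPt ‖z - x‖ (𝓝 (Metric.infDist x F)) := ClusterPt.mono hc hlim
    exact eq_of_nhds_neBot this
  have hzp : dist z p < δ := by
    have h1 : dist z x ≤ dist x p := by
      rw [dist_eq_norm, hznorm]
      exact Metric.infDist_le_dist_of_mem hp
    linarith [dist_triangle z x p]
  have hzF : z ∈ F := mem_of_mem_closure_of_proj_nonempty hzcl (hδ z hzp).exists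
  exact (hδ x hxδ).unique (mem_proj_of_norm_eq_infDist hzF hznorm) hPx

/-- First-order expansion of the squared distance at `x`, with an error controlled by the
displacement of the projection: the upper estimate tests the minimality of `w` for `y` against `z`,
the lower one that of `z` for `x` against `w`. -/
theorem abs_sq_infDist_sub_le {F : Set E} {x y z w : E} (hz : z ∈ proj F x) (hw : w ∈ proj F y) :
    |Metric.infDist y F ^ 2 - Metric.infDist x F ^ 2 - inner ℝ ((2 : ℝ) • (x - z)) (y - x)| ≤
      (‖y - x‖ + 2 * ‖w - z‖) * ‖y - x‖ := by
  rw [infDist_eq_norm_of_mem_proj hz, infDist_eq_norm_of_mem_proj hw]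
  have h1 : ‖w - y‖ ^ 2 ≤ ‖z - y‖ ^ 2 := by gcongr; exact hw.2 z hz.1
  have h2 : ‖z - x‖ ^ 2 ≤ ‖w - x‖ ^ 2 := by gcongr; exact hz.2 w hw.1
  have e1 : ‖z - y‖ ^ 2 = ‖z - x‖ ^ 2 + inner ℝ ((2 : ℝ) • (x - z)) (y - x) + ‖y - x‖ ^ 2 := by
    rw [show z - y = (z - x) - (y - x) by abel, norm_sub_sq_real, inner_smul_left,
      ← neg_sub z x, inner_neg_left]
    simp; ring
  have e2 : ‖w - x‖ ^ 2 = ‖w - y‖ ^ 2 - inner ℝ ((2 : ℝ) • (x - z)) (y - x)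
      - ‖y - x‖ ^ 2 + 2 * inner ℝ (w - z) (y - x) := by
    rw [show w - x = (w - y) + (y - x) by abel, norm_add_sq_real, inner_smul_left,
      show w - y = (w - z) - (x - z) - (y - x) by abel, inner_sub_left _ (y - x),
      inner_sub_left (w - z), real_inner_self_eq_norm_sq]
    simp; ring
  have h3 := real_inner_le_norm (w - z) (y - x)
  have h4 : 0 ≤ ‖w - z‖ * ‖y - x‖ := by positivity
  rw [abs_le]
  constructor <;> nlinarith

theorem hasGradientAt_sq_infDist [CompleteSpace E] {F : Set E} {x : E} {P : E → E}
    (hP : ∀ᶠ y in 𝓝 x, P y ∈ proj F y) (hc : ContinuousAt P x) :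
    HasGradientAt (fun y => Metric.infDist y F ^ 2) ((2 : ℝ) • (x - P x)) x := by
  rw [hasGradientAt_iff_isLittleO, Asymptotics.isLittleO_iff]
  intro c hpos
  have hlim : Tendsto (fun y => ‖y - x‖ + 2 * ‖P y - P x‖) (𝓝 x) (𝓝 0) := by
    have : ContinuousAt (fun y => ‖y - x‖ + 2 * ‖P y - P x‖) x := by fun_prop
    simpa using this.tendsto
  filter_upwards [hP, hlim.eventually_lt_const hpos] with y hy hlt
  rw [Real.norm_eq_abs]
  exact (abs_sq_infDist_sub_le hP.self_of_nhds hy).trans (by gcongr)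

theorem ProxRegularAt.exists_hasGradientAt [FiniteDimensional ℝ E] {F : Set E} {p : E}
    (h : ProxRegularAt F p) : ∃ P : E → E, ∀ᶠ x in 𝓝 p, P x ∈ proj F x ∧
      HasGradientAt (fun y => Metric.infDist y F ^ 2) ((2 : ℝ) • (x - P x)) x := by
  obtain ⟨P, hP⟩ := (h.2.mono fun _ hx => hx.exists).choice
  obtain ⟨δ, hδ0, hδ⟩ := Metric.eventually_nhds_iff.1 h.2
  refine ⟨P, ?_⟩
  filter_upwards [hP.eventually_nhds, Metric.ball_mem_nhds p (half_pos hδ0)] with x hx hxδ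
  exact ⟨hx.self_of_nhds,
    hasGradientAt_sq_infDist hx (continuousAt_proj h.1 (fun y hy => hδ hy) hx hxδ)⟩

/-- A bound on the normal cones at `p` passes, with any larger constant, to the residuals
`x - Pᵢ x` at nearby points. -/
theorem eventually_sqrt_sum_le [FiniteDimensional ℝ E] {m : ℕ} {F : Fin m → Set E} {p : E}
    {k₀ k : ℝ} (hk₀ : 0 < k₀) (hk : k₀ < k)
    (hbound : ∀ y : Fin m → E, (∀ i, y i ∈ normalCone (F i) p) →
      √(∑ i, ‖y i‖ ^ 2) ≤ k₀ * ‖∑ i, y i‖)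
    {P : Fin m → E → E} (hP : ∀ i, ∀ᶠ x in 𝓝 p, P i x ∈ proj (F i) x) :
    ∀ᶠ x in 𝓝 p, √(∑ i, ‖x - P i x‖ ^ 2) ≤ k * ‖∑ i, (x - P i x)‖ := by
  by_contra hcon
  obtain ⟨x, hx, hx'⟩ := exists_seq_forall_of_frequently
    ((not_eventually.1 hcon).and_eventually (eventually_all.2 hP))
  set s : ℕ → ℝ := fun n => √(∑ i, ‖x n - P i (x n)‖ ^ 2) with hs
  have hk0 : 0 < k := hk₀.trans hk
  have hspos : ∀ n, 0 < s n := fun n =>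
    (by positivity : 0 ≤ k * ‖∑ i, (x n - P i (x n))‖).trans_lt (not_le.1 (hx' n).1)
  -- The residuals, scaled so that their joint Euclidean norm is `1`.
  let w : ℕ → Fin m → E := fun n i => (s n)⁻¹ • (x n - P i (x n))
  have hwball : ∀ n, w n ∈ Metric.closedBall (0 : Fin m → E) 1 := by
    intro n
    rw [mem_closedBall_zero_iff, pi_norm_le_iff_of_nonneg zero_le_one]
    intro i
    rw [norm_smul, norm_inv, Real.norm_of_nonneg (hspos n).le, inv_mul_le_one₀ (hspos n)]
    exact norm_le_sqrt_sum_sq (fun i => x n - P i (x n)) i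
  have hwsq : ∀ n, ∑ i, ‖w n i‖ ^ 2 = 1 := by
    intro n
    have h1 : s n ^ 2 = ∑ i, ‖x n - P i (x n)‖ ^ 2 :=
      Real.sq_sqrt (Finset.sum_nonneg fun _ _ => sq_nonneg _)
    simp only [w, norm_smul, norm_inv, Real.norm_of_nonneg (hspos n).le, mul_pow]
    rw [← Finset.mul_sum, ← h1, inv_pow, inv_mul_cancel₀ (pow_ne_zero 2 (hspos n).ne')]
  have hwsum : ∀ n, k * ‖∑ i, w n i‖ ≤ 1 := by
    intro n
    simp only [w]
    rw [← Finset.smul_sum, norm_smul, norm_inv, Real.norm_of_nonneg (hspos n).le,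
      mul_left_comm, inv_mul_le_one₀ (hspos n)]
    exact (not_le.1 (hx' n).1).le
  obtain ⟨y, -, φ, hφ, hy⟩ := (isCompact_closedBall (0 : Fin m → E) 1).tendsto_subseq hwball
  have hyi : ∀ i, Tendsto (fun n => w (φ n) i) atTop (𝓝 (y i)) := tendsto_pi_nhds.1 hy
  have hycone : ∀ i, y i ∈ normalCone (F i) p := fun i =>
    ⟨fun n => (s (φ n))⁻¹, fun n => x (φ n), fun n => P i (x (φ n)),
      fun n => (inv_pos.2 (hspos _)).le, hx.comp hφ.tendsto_atTop, fun n => (hx' _).2 i, hyi i⟩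
  have hysq : ∑ i, ‖y i‖ ^ 2 = 1 :=
    tendsto_nhds_unique (tendsto_finsetSum _ fun i _ => (hyi i).norm.pow 2)
      (tendsto_const_nhds.congr fun n => (hwsq (φ n)).symm)
  have hysum : k * ‖∑ i, y i‖ ≤ 1 :=
    le_of_tendsto ((tendsto_finsetSum _ fun i _ => hyi i).norm.const_mul k)
      (Eventually.of_forall fun n => hwsum (φ n))
  have hb := hbound y hycone
  rw [hysq, Real.sqrt_one] at hb
  have hpos : 0 < ‖∑ i, y i‖ := by
    by_contra h
    nlinarith [norm_nonneg (∑ i, y i)]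
  nlinarith

theorem hasGradientAt_meanSqDist [CompleteSpace E] {m : ℕ} {F : Fin m → Set E} {x : E}
    {v : Fin m → E}
    (h : ∀ i, HasGradientAt (fun y => Metric.infDist y (F i) ^ 2) ((2 : ℝ) • v i) x) :
    HasGradientAt (meanSqDist F) ((m : ℝ)⁻¹ • ∑ i, v i) x := by
  rw [hasGradientAt_iff_hasFDerivAt]
  have := (HasFDerivAt.fun_sum (u := Finset.univ) fun i _ => (h i).hasFDerivAt).const_mul
    (1 / (2 * (m : ℝ)))
  refine this.congr_fderiv ?_
  ext u
  simp [Finset.mul_sum]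
  refine Finset.sum_congr rfl fun i _ => ?_
  ring

end VarAnalysis

open VarAnalysis in
theorem mainTheorem12 {E : Type*} [NormedAddCommGroup E] [InnerProductSpace ℝ E]
    [FiniteDimensional ℝ E] {m : ℕ} (F : Fin m → Set E) (xbar : E)
    (hprox : ∀ i, VarAnalysis.ProxRegularAt (F i) xbar)
    (hreg : VarAnalysis.StronglyRegularAt F xbar)
    (k : ℝ) (hk : VarAnalysis.condModulus F xbar < (k : EReal)) :
    ∀ᶠ x in 𝓝 xbar,
      DifferentiableAt ℝ (VarAnalysis.meanSqDist F) x ∧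
      1 / 2 * ‖gradient (VarAnalysis.meanSqDist F) x‖ ^ 2 ≤ VarAnalysis.meanSqDist F x ∧
      VarAnalysis.meanSqDist F x ≤
        k ^ 2 * (m : ℝ) / 2 * ‖gradient (VarAnalysis.meanSqDist F) x‖ ^ 2 := by
  obtain ⟨_, ⟨k₀, ⟨hk₀, hbound⟩, rfl⟩, hlt⟩ := sInf_lt_iff.1 hk
  have hlt' : k₀ < k := EReal.coe_lt_coe_iff.1 hlt
  choose P hP using fun i => (hprox i).exists_hasGradientAt
  filter_upwards [eventually_all.2 hP,
    eventually_sqrt_sum_le hk₀ hlt' hbound fun i => (hP i).mono fun _ h => h.1] with x hx hle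
  have hgrad := hasGradientAt_meanSqDist fun i => (hx i).2
  have hval : meanSqDist F x = 1 / (2 * (m : ℝ)) * ∑ i, ‖x - P i x‖ ^ 2 := by
    simp only [meanSqDist, infDist_eq_norm_of_mem_proj (hx _).1, norm_sub_rev]
  refine ⟨hgrad.differentiableAt, ?_⟩
  rw [hgrad.gradient, hval, norm_smul, norm_inv, Real.norm_natCast, mul_pow]
  have hupper := norm_sum_sq_le fun i => x - P i x
  rw [Fintype.card_fin] at hupper
  have hlower : ∑ i, ‖x - P i x‖ ^ 2 ≤ k ^ 2 * ‖∑ i, (x - P i x)‖ ^ 2 := by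
    rw [← mul_pow]
    exact (Real.sqrt_le_left (mul_nonneg (hk₀.trans hlt').le (norm_nonneg _))).1 hle
  -- For `m = 0` the factor `1 / (2 * m)` is a junk `0`, and every term vanishes.
  rcases Nat.eq_zero_or_pos m with rfl | hm
  · simp
  have hm' : (0 : ℝ) < m := Nat.cast_pos.2 hm
  constructor
  · calc 1 / 2 * ((m : ℝ)⁻¹ ^ 2 * ‖∑ i, (x - P i x)‖ ^ 2)
        ≤ 1 / 2 * ((m : ℝ)⁻¹ ^ 2 * (m * ∑ i, ‖x - P i x‖ ^ 2)) := by gcongr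
      _ = 1 / (2 * (m : ℝ)) * ∑ i, ‖x - P i x‖ ^ 2 := by field_simp
  · calc 1 / (2 * (m : ℝ)) * ∑ i, ‖x - P i x‖ ^ 2
        ≤ 1 / (2 * (m : ℝ)) * (k ^ 2 * ‖∑ i, (x - P i x)‖ ^ 2) := by gcongr
      _ = k ^ 2 * (m : ℝ) / 2 * ((m : ℝ)⁻¹ ^ 2 * ‖∑ i, (x - P i x)‖ ^ 2) := by field_simp
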